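/- Let $V$ be a complex vector space of finite dimension $n$ and let $G\subset GL(V)$ be a finite complex reflection group, i.e. a finite group generated by reflections (diagonalizable elements all but one of whose eigenvalues, counted with multiplicity, equal $1$). Let $\mathbb{C}[V]$ be the symmetric algebra of $V^*$, i.e. the algebra of polynomial functions on $V$, with the action $(h\cdot F)(v)=F(h^{-1}v)$, let $\mathbb{C}[V]^G$ be the algebra of invariants and $S(j)$ its part of degree $j$ for the natural grading. A set of basic invariants is a tuple $x=(x^1,\dots,x^n)$ of algebraically independent homogeneous generators of $\mathbb{C}[V]^G$ of degrees $d_1\le\dots\le d_n$; put $d=(d_1,\dots,d_n)$ and $d\cdot b=d_1b_1+\dots+d_nb_n$ for $b\in\mathbb{Z}_{\ge0}^n$. Let $(g,\zeta,q)$, with $g\in G$, $\zeta\in\mathbb{C}$, $q\in V$, be an admissible triplet, i.e.: $q$ is an eigenvector of $g$ with eigenvalue $\zeta$, and $\zeta$ is a primitive $d_n$-th root of unity; the Jacobian matrix $(\partial x^\alpha/\partial z^\beta(q))_{\alpha,\beta}$, for linear coordinates $z^1,\dots,z^n$ of $V$, is invertible; and the eigenvalues of $g$ on $V$, with multiplicity,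 are $\zeta^{1-d_\alpha}$, $1\le\alpha\le n$. Call a basis $z=(z^1,\dots,z^n)$ of $V^*$ adapted if $g\cdot z^\alpha=\zeta^{d_\alpha-1}z^\alpha$ for all $\alpha$, and for an adapted basis let $V(g,\zeta,q)(j)$ be the span of the monomials $z^b=\prod_\alpha (z^\alpha)^{b_\alpha}$ with $d\cdot b=j$. The monomials $x^a=\prod_\alpha (x^\alpha)^{a_\alpha}$, $a\in\mathbb{Z}_{\ge0}^n$, form a basis of the vector space $\mathbb{C}[V]^G$. With $[x-x(q)]^a=\prod_\alpha(x^\alpha-x^\alpha(q))^{a_\alpha}$ and $b!=b_1!\cdots b_n!$, define linear maps $\varphi,\psi:\mathbb{C}[V]^G\to\mathbb{C}[V]$ by $$\varphi(x^a)=\sum_{b\in\mathbb{Z}_{\ge0}^n}\frac1{b!}\frac{\partial^b[x-x(q)]^a}{\partial z^b}(q)\,z^b,\qquad \psi(x^a)=\sum_{b\in\mathbb{Z}_{\ge0}^n,\ d\cdot b=d\cdot a}\frac1{b!}\frac{\partial^b[x-x(q)]^a}{\partial z^b}(q)\,z^b .$$ Then, for every adapted basis $z$: (i) $\varphi$ does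 not depend on the choice of the set of basic invariants $x$ or of the basis $z$ of $V^*$ (adapted or not), and it is a homomorphism of $\mathbb{C}$-algebras. (ii) $\varphi(S(k))\subset\bigoplus_{j\ge0}V(g,\zeta,q)(k+d_nj)$ for every $k\in\mathbb{Z}_{\ge0}$. (iii) $\psi$ does not depend on the choice of the set of basic invariants $x$ or of the adapted basis $z$, and it is a homomorphism of $\mathbb{C}$-algebras. (iv) $\mathbb{C}[V]^G=\bigoplus_{j\ge0}S(j)$ and $\mathbb{C}[V]=\bigoplus_{j\ge0}V(g,\zeta,q)(j)$ are graded algebras, and $\psi$ is an isomorphism of graded algebras between them: it is an algebra isomorphism with $\psi(S(j))=V(g,\zeta,q)(j)$ for every $j$. -/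

import Mathlib

open Module

noncomputable section

namespace ReflectionInvariants

variable {V : Type*} [AddCommGroup V] [Module ℂ V]

/-- `ℂ[V]`, the symmetric algebra of the dual space `V* = Hom(V, ℂ)`. -/
abbrev PolyAlg (V : Type*) [AddCommGroup V] [Module ℂ V] : Type _ :=
  SymmetricAlgebra ℂ (Dual ℂ V)

/-- The inclusion `V* ⊂ ℂ[V]`. -/
abbrev lin (l : Dual ℂ V) : PolyAlg V := SymmetricAlgebra.ι ℂ (Dual ℂ V) l

/-- The value `F(v)` of `F ∈ ℂ[V]` at `v ∈ V`. -/
def evalAt (v : V) : PolyAlg V →ₐ[ℂ] ℂ :=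
  SymmetricAlgebra.lift (Dual.eval ℂ V v)

/-- The action of `g ∈ GL(V)` on `ℂ[V]`: the algebra endomorphism with
`(g · l)(v) = l (g⁻¹ v)` for `l ∈ V*`. -/
def act (g : V ≃ₗ[ℂ] V) : PolyAlg V →ₐ[ℂ] PolyAlg V :=
  SymmetricAlgebra.lift
    ((SymmetricAlgebra.ι ℂ (Dual ℂ V)).comp (g⁻¹ : V ≃ₗ[ℂ] V).toLinearMap.dualMap)

/-- The action on all of `ℂ[V]` is the one on functions: `(g · F)(v) = F (g⁻¹ v)`. -/
theorem evalAt_act (g : V ≃ₗ[ℂ] V) (F : PolyAlg V) (v : V) :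
    evalAt v (act g F) = evalAt ((g⁻¹ : V ≃ₗ[ℂ] V) v) F := by
  have h : (evalAt v).comp (act g) = evalAt ((g⁻¹ : V ≃ₗ[ℂ] V) v) := by
    apply SymmetricAlgebra.algHom_ext
    ext l
    simp [evalAt, act, SymmetricAlgebra.lift_ι_apply]
  exact DFunLike.congr_fun h F

/-- The algebra `ℂ[V]^G` of `G`-invariant elements. -/
def invariants (G : Subgroup (V ≃ₗ[ℂ] V)) : Subalgebra ℂ (PolyAlg V) :=
  ⨅ g ∈ G, AlgHom.equalizer (act g) (AlgHom.id ℂ (PolyAlg V))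

theorem mem_invariants (G : Subgroup (V ≃ₗ[ℂ] V)) (F : PolyAlg V) :
    F ∈ invariants G ↔ ∀ g ∈ G, act g F = F := by
  simp [invariants, Algebra.mem_iInf]

/-- The homogeneous polynomials of degree `j` (natural grading of `ℂ[V]`): the span of the
products of `j` linear forms. -/
def homogeneousPart (V : Type*) [AddCommGroup V] [Module ℂ V] (j : ℕ) :
    Submodule ℂ (PolyAlg V) :=
  (LinearMap.range (SymmetricAlgebra.ι ℂ (Dual ℂ V))) ^ j

/-- `S(j)`, the degree `j` part of `ℂ[V]^G`. -/
def invariantPart (G : Subgroup (V ≃ₗ[ℂ] V)) (j : ℕ) : Submodule ℂ (invariants G) :=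
  (homogeneousPart V j).comap (invariants G).val.toLinearMap

/-- A reflection: diagonalizable, with all but one of its eigenvalues (counted with
multiplicity) equal to `1`. -/
def IsReflection (g : V ≃ₗ[ℂ] V) : Prop :=
  (⨆ μ : ℂ, End.eigenspace (g.toLinearMap : End ℂ V) μ) = ⊤ ∧
    finrank ℂ (End.eigenspace (g.toLinearMap : End ℂ V) 1) + 1 = finrank ℂ V

/-- A finite complex reflection group: a finite subgroup of `GL(V)` generated by reflections. -/
structure IsFiniteReflectionGroup (G : Subgroup (V ≃ₗ[ℂ] V)) : Prop where
  finite : Finite G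
  generated : Subgroup.closure {g : V ≃ₗ[ℂ] V | g ∈ G ∧ IsReflection g} = G

variable {n : ℕ}

/-- `x¹, …, xⁿ` is a set of basic invariants of `G`, of degrees `d₁ ≤ … ≤ dₙ`: algebraically
independent homogeneous generators of `ℂ[V]^G`. -/
structure IsBasicInvariants (G : Subgroup (V ≃ₗ[ℂ] V)) (d : Fin n → ℕ)
    (x : Fin n → invariants G) : Prop where
  algebraicIndependent : AlgebraicIndependent ℂ x
  generate : Algebra.adjoin ℂ (Set.range x) = ⊤
  homogeneous : ∀ α, x α ∈ invariantPart G (d α)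
  monotone : Monotone d

/-- The basis `x^a`, `a ∈ ℕⁿ`, of the vector space `ℂ[V]^G`. -/
def IsBasicInvariants.monomialBasis {G : Subgroup (V ≃ₗ[ℂ] V)} {d : Fin n → ℕ}
    {x : Fin n → invariants G} (hx : IsBasicInvariants G d x) :
    Basis (Fin n →₀ ℕ) ℂ (invariants G) :=
  (MvPolynomial.basisMonomials (Fin n) ℂ).map
    (AlgEquiv.ofBijective (MvPolynomial.aeval x) ⟨hx.algebraicIndependent, by
      rw [← AlgHom.range_eq_top, ← Algebra.adjoin_range_eq_range_aeval, hx.generate]⟩).toLinearEquiv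

theorem IsBasicInvariants.monomialBasis_apply {G : Subgroup (V ≃ₗ[ℂ] V)} {d : Fin n → ℕ}
    {x : Fin n → invariants G} (hx : IsBasicInvariants G d x) (a : Fin n →₀ ℕ) :
    hx.monomialBasis a = ∏ α, x α ^ a α := by
  have h : hx.monomialBasis a = MvPolynomial.aeval x (MvPolynomial.monomial a (1 : ℂ)) := by
    simp [monomialBasis]
    rfl
  rw [h, MvPolynomial.aeval_monomial, map_one, one_mul, Finsupp.prod_fintype _ _ (by simp)]

/-- `d · b = d₁ b₁ + ⋯ + dₙ bₙ`. -/
def wdeg (d : Fin n → ℕ) (b : Fin n →₀ ℕ) : ℕ := ∑ α, d α * b α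

/-- The highest degree `dₙ`. -/
def topDegree (d : Fin n → ℕ) : ℕ := Finset.univ.sup d

/-- The monomial `z^b` in the coordinates `z¹, …, zⁿ`. -/
def zpowMonomial (z : Basis (Fin n) ℂ (Dual ℂ V)) (b : Fin n →₀ ℕ) : PolyAlg V :=
  ∏ β, lin (z β) ^ b β

/-- `∂/∂z^β`, the partial derivative in the coordinates `z¹, …, zⁿ`, through the identification
of `ℂ[V]` with the polynomial ring in `z¹, …, zⁿ`. -/
def partialDeriv (z : Basis (Fin n) ℂ (Dual ℂ V)) (β : Fin n) : End ℂ (PolyAlg V) :=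
  (SymmetricAlgebra.equivMvPolynomial z).symm.toLinearMap ∘ₗ
    (MvPolynomial.pderiv β).toLinearMap ∘ₗ
      (SymmetricAlgebra.equivMvPolynomial z).toLinearMap

/-- `∂^b/∂z^b = (∂/∂z¹)^{b₁} ⋯ (∂/∂zⁿ)^{bₙ}`. -/
def multiDeriv (z : Basis (Fin n) ℂ (Dual ℂ V)) (b : Fin n →₀ ℕ) : End ℂ (PolyAlg V) :=
  (List.ofFn fun β => partialDeriv z β ^ b β).prod

/-- The product `[x - x(q)]^a = ∏ (x^α - x^α(q))^{a_α}`. -/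
def shiftedMonomial {G : Subgroup (V ≃ₗ[ℂ] V)} (x : Fin n → invariants G) (q : V)
    (a : Fin n →₀ ℕ) : PolyAlg V :=
  ∏ α, ((x α : PolyAlg V) - algebraMap ℂ (PolyAlg V) (evalAt q (x α : PolyAlg V))) ^ a α

/-- The Taylor coefficient `(1/b!) (∂^b [x - x(q)]^a / ∂z^b)(q)`. -/
def taylorCoeff {G : Subgroup (V ≃ₗ[ℂ] V)} (x : Fin n → invariants G)
    (z : Basis (Fin n) ℂ (Dual ℂ V)) (q : V) (a b : Fin n →₀ ℕ) : ℂ :=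
  (1 / ((∏ β, (b β).factorial : ℕ) : ℂ)) * evalAt q (multiDeriv z b (shiftedMonomial x q a))

/-- The linear map `φ : ℂ[V]^G → ℂ[V]`,
`x^a ↦ ∑_b (1/b!) (∂^b [x - x(q)]^a / ∂z^b)(q) z^b` (only finitely many terms are nonzero). -/
def taylorMap {G : Subgroup (V ≃ₗ[ℂ] V)} {d : Fin n → ℕ} {x : Fin n → invariants G}
    (hx : IsBasicInvariants G d x) (z : Basis (Fin n) ℂ (Dual ℂ V)) (q : V) :
    invariants G →ₗ[ℂ] PolyAlg V :=
  hx.monomialBasis.constr ℂ fun a =>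
    ∑ᶠ b : Fin n →₀ ℕ, taylorCoeff x z q a b • zpowMonomial z b

/-- The linear map `ψ : ℂ[V]^G → ℂ[V]`, the sum defining `φ(x^a)` being restricted to the `b`
with `d · b = d · a`. -/
def truncatedTaylorMap {G : Subgroup (V ≃ₗ[ℂ] V)} {d : Fin n → ℕ} {x : Fin n → invariants G}
    (hx : IsBasicInvariants G d x) (z : Basis (Fin n) ℂ (Dual ℂ V)) (q : V) :
    invariants G →ₗ[ℂ] PolyAlg V :=
  hx.monomialBasis.constr ℂ fun a =>
    ∑ᶠ (b : Fin n →₀ ℕ) (_ : wdeg d b = wdeg d a), taylorCoeff x z q a b • zpowMonomial z b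

/-- The span of the monomials `z^b` with `d · b = j`; for coordinates adapted to a triplet this
is the piece `V(g, ζ, q)(j)` of the second grading of `ℂ[V]`. -/
def weightedPart (d : Fin n → ℕ) (z : Basis (Fin n) ℂ (Dual ℂ V)) (j : ℕ) :
    Submodule ℂ (PolyAlg V) :=
  Submodule.span ℂ (zpowMonomial z '' {b | wdeg d b = j})

/-- The Jacobian matrix `(∂x^α/∂z^β (q))`. -/
def jacobianAt {G : Subgroup (V ≃ₗ[ℂ] V)} (x : Fin n → invariants G)
    (z : Basis (Fin n) ℂ (Dual ℂ V)) (q : V) : Matrix (Fin n) (Fin n) ℂ :=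
  Matrix.of fun α β => evalAt q (partialDeriv z β (x α : PolyAlg V))

/-- The triplet `(g, ζ, q)` is admissible (with `x` a set of basic invariants of `G` of degrees
`d`). Invertibility of the Jacobian does not depend on the coordinates `z`. -/
structure IsAdmissible [FiniteDimensional ℂ V] (G : Subgroup (V ≃ₗ[ℂ] V)) (d : Fin n → ℕ)
    (x : Fin n → invariants G) (g : V ≃ₗ[ℂ] V) (ζ : ℂ) (q : V) : Prop where
  mem : g ∈ G
  eigenvector : End.HasEigenvector (g.toLinearMap : End ℂ V) ζ q
  primitive : IsPrimitiveRoot ζ (topDegree d)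
  jacobian : ∃ z : Basis (Fin n) ℂ (Dual ℂ V), IsUnit (jacobianAt x z q).det
  /-- the eigenvalues of `g` on `V`, with multiplicity, are `ζ ^ (1 - d_α)` -/
  eigenvalues : (g.toLinearMap : End ℂ V).charpoly.roots =
    Finset.univ.val.map fun α => ζ ^ (1 - (d α : ℤ))

/-- The coordinates `z¹, …, zⁿ` are adapted to the triplet: `g · z^α = ζ ^ (d_α - 1) z^α`. -/
def IsAdapted (d : Fin n → ℕ) (g : V ≃ₗ[ℂ] V) (ζ : ℂ) (z : Basis (Fin n) ℂ (Dual ℂ V)) : Prop :=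
  ∀ α, act g (lin (z α)) = ζ ^ ((d α : ℤ) - 1) • lin (z α)

end ReflectionInvariants

end

open ReflectionInvariants

/-! Let `T_q` be translation by `q`. Taylor's formula identifies `φ` with the algebra homomorphism
`x^α ↦ T_q x^α - x^α(q)` (`taylorMap_eq`), in which no coordinates occur. The map `ζ g⁻¹` fixes `q`,
so its pullback on `ℂ[V]` (`twist`) commutes with `T_q` and with evaluation at `q`. It multiplies an
invariant of degree `k` by `ζ^k`, and the monomial `z^b` in adapted coordinates by `ζ^(d·b)`.

Two consequences follow. First, invariants of degree strictly between `0` and `dₙ` vanish at `q`.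
Hence `φ F = T_q F - F(q)` for every invariant `F` of degree in `[1, dₙ]` (`taylorHom_of_mem`), a
formula without reference to `x`; it applies to any other basic invariants, since the degrees are
determined by `G` (`degree_eq`). Second, `z^b` occurs in `φ(x^α)` only if `d·b ≡ d_α` modulo `dₙ`;
as `d·b > 0` and `d_α ≤ dₙ`, this forces `d·b ∈ d_α + dₙ ℕ` (`weightMod_generator`), and (ii)
follows by multiplying.

Thus `ψ` extracts the component of lowest possible weight, an operation that is multiplicative
(`component_mul`), so `ψ` is a homomorphism. The images of the `x^α` are weighted homogeneous of
weight `d_α`, and their linear coefficients form the Jacobian matrix at `q`. Its invertibility makes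
them generate `ℂ[V]`, by induction on the weight (`adjoin_eq_top_of_isUnit_linearPart`). Since `n`
generators of a polynomial ring in `n` variables are algebraically independent, `ψ` is an
isomorphism. -/

noncomputable section

namespace ReflectionInvariants

open MvPolynomial

/-! ### Weights in polynomial rings, and generators detected by linear parts -/

section Polynomials

variable {σ τ K : Type*}

theorem exists_of_coeff_mul_ne_zero [CommSemiring K] {p q : MvPolynomial σ K}
    {b : σ →₀ ℕ} (h : coeff b (p * q) ≠ 0) :
    ∃ b₁ b₂, b₁ + b₂ = b ∧ coeff b₁ p ≠ 0 ∧ coeff b₂ q ≠ 0 := by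
  classical
  rw [coeff_mul] at h
  obtain ⟨⟨b₁, b₂⟩, hb, hne⟩ := Finset.exists_ne_zero_of_sum_ne_zero h
  exact ⟨b₁, b₂, Finset.HasAntidiagonal.mem_antidiagonal.mp hb,
    left_ne_zero_of_mul hne, right_ne_zero_of_mul hne⟩

/-- All monomials of `p` have weight at least `k`. -/
def WeightGE [CommSemiring K] (w : σ → ℕ) (k : ℕ) (p : MvPolynomial σ K) : Prop :=
  ∀ b, coeff b p ≠ 0 → k ≤ Finsupp.weight w b

theorem WeightGE.mul [CommSemiring K] {w : σ → ℕ} {k l : ℕ} {p q : MvPolynomial σ K}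
    (hp : WeightGE w k p) (hq : WeightGE w l q) : WeightGE w (k + l) (p * q) := by
  intro b hb
  obtain ⟨b₁, b₂, rfl, h₁, h₂⟩ := exists_of_coeff_mul_ne_zero hb
  rw [map_add]
  exact add_le_add (hp _ h₁) (hq _ h₂)

theorem WeightGE.one [CommSemiring K] (w : σ → ℕ) : WeightGE w 0 (1 : MvPolynomial σ K) :=
  fun _ _ => Nat.zero_le _

theorem WeightGE.component_eq_zero [CommSemiring K] {w : σ → ℕ} {k l : ℕ} {p : MvPolynomial σ K}
    (hp : WeightGE w k p) (h : l < k) : weightedHomogeneousComponent w l p = 0 := by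
  classical
  ext b
  rw [coeff_weightedHomogeneousComponent, coeff_zero]
  split_ifs with hb
  · by_contra hne
    have := hp b hne
    omega
  · rfl

theorem _root_.MvPolynomial.IsWeightedHomogeneous.weightGE [CommSemiring K] {w : σ → ℕ} {k : ℕ}
    {p : MvPolynomial σ K} (hp : IsWeightedHomogeneous w p k) : WeightGE w k p :=
  fun _ hb => (hp hb).ge

theorem WeightGE.sub_component [CommRing K] {w : σ → ℕ} {k : ℕ} {p : MvPolynomial σ K}
    (hp : WeightGE w k p) : WeightGE w (k + 1) (p - weightedHomogeneousComponent w k p) := by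
  classical
  intro b hb
  rw [coeff_sub, coeff_weightedHomogeneousComponent] at hb
  split_ifs at hb with h
  · simp at hb
  · have := hp b (by simpa using hb)
    omega

/-- Taking the component of lowest weight is multiplicative. -/
theorem WeightGE.component_mul [CommRing K] {w : σ → ℕ} {k l : ℕ} {p q : MvPolynomial σ K}
    (hp : WeightGE w k p) (hq : WeightGE w l q) :
    weightedHomogeneousComponent w (k + l) (p * q) =
      weightedHomogeneousComponent w k p * weightedHomogeneousComponent w l q := by
  set p₀ := weightedHomogeneousComponent w k p
  set q₀ := weightedHomogeneousComponent w l q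
  have hp₀' : IsWeightedHomogeneous w p₀ k := weightedHomogeneousComponent_isWeightedHomogeneous ..
  have hq₀' : IsWeightedHomogeneous w q₀ l := weightedHomogeneousComponent_isWeightedHomogeneous ..
  -- Both terms in the bracket have weight at least `k + l + 1`, because removing the lowest
  -- component raises the bound by one.
  have e : p * q = p₀ * q₀ + (p₀ * (q - q₀) + (p - p₀) * q) := by ring
  rw [e, map_add, map_add, (hp₀'.mul hq₀').weightedHomogeneousComponent_same,
    (hp₀'.weightGE.mul hq.sub_component).component_eq_zero (by omega),
    (hp.sub_component.mul hq).component_eq_zero (by omega), add_zero, add_zero]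

theorem WeightGE.pow [CommSemiring K] {w : σ → ℕ} {k : ℕ} {p : MvPolynomial σ K}
    (hp : WeightGE w k p) (m : ℕ) : WeightGE w (k * m) (p ^ m) := by
  induction m with
  | zero => exact WeightGE.one w
  | succ m ih => rw [pow_succ, Nat.mul_succ]; exact ih.mul hp

theorem WeightGE.component_pow [CommRing K] {w : σ → ℕ} {k : ℕ} {p : MvPolynomial σ K}
    (hp : WeightGE w k p) (m : ℕ) :
    weightedHomogeneousComponent w (k * m) (p ^ m) = weightedHomogeneousComponent w k p ^ m := by
  induction m with
  | zero =>
    rw [pow_zero, pow_zero]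
    exact (isWeightedHomogeneous_one K w).weightedHomogeneousComponent_same
  | succ m ih => rw [pow_succ, Nat.mul_succ, (hp.pow m).component_mul hp, ih, pow_succ]

theorem WeightGE.prod [CommSemiring K] {ι : Type*} {w : σ → ℕ} {k : ι → ℕ}
    {p : ι → MvPolynomial σ K} (s : Finset ι) (hp : ∀ i, WeightGE w (k i) (p i)) :
    WeightGE w (∑ i ∈ s, k i) (∏ i ∈ s, p i) := by
  classical
  induction s using Finset.induction_on with
  | empty => exact WeightGE.one w
  | insert i s hi ih => rw [Finset.sum_insert hi, Finset.prod_insert hi]; exact (hp i).mul ih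

theorem WeightGE.component_prod [CommRing K] {ι : Type*} {w : σ → ℕ} {k : ι → ℕ}
    {p : ι → MvPolynomial σ K} (s : Finset ι) (hp : ∀ i, WeightGE w (k i) (p i)) :
    weightedHomogeneousComponent w (∑ i ∈ s, k i) (∏ i ∈ s, p i) =
      ∏ i ∈ s, weightedHomogeneousComponent w (k i) (p i) := by
  classical
  induction s using Finset.induction_on with
  | empty => exact (isWeightedHomogeneous_one K w).weightedHomogeneousComponent_same
  | insert i s hi ih =>
    rw [Finset.sum_insert hi, Finset.prod_insert hi, Finset.prod_insert hi,
      (hp i).component_mul (WeightGE.prod s hp), ih]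

/-- All monomials of `p` have weights in `k + N ℕ`. -/
def WeightMod [CommSemiring K] (w : σ → ℕ) (N k : ℕ) (p : MvPolynomial σ K) : Prop :=
  ∀ b, coeff b p ≠ 0 → ∃ j, Finsupp.weight w b = k + N * j

section WeightMod

variable [CommSemiring K] {w : σ → ℕ} {N : ℕ}

theorem WeightMod.weightGE {k : ℕ} {p : MvPolynomial σ K} (hp : WeightMod w N k p) :
    WeightGE w k p := by
  intro b hb
  obtain ⟨j, hj⟩ := hp b hb
  omega

theorem WeightMod.mul {k l : ℕ} {p q : MvPolynomial σ K}
    (hp : WeightMod w N k p) (hq : WeightMod w N l q) : WeightMod w N (k + l) (p * q) := by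
  intro b hb
  obtain ⟨b₁, b₂, rfl, h₁, h₂⟩ := exists_of_coeff_mul_ne_zero hb
  obtain ⟨i, hi⟩ := hp _ h₁
  obtain ⟨j, hj⟩ := hq _ h₂
  exact ⟨i + j, by rw [map_add, hi, hj]; ring⟩

theorem WeightMod.one : WeightMod w N 0 (1 : MvPolynomial σ K) := by
  classical
  intro b hb
  rw [coeff_one] at hb
  obtain rfl : 0 = b := by by_contra h; simp [h] at hb
  exact ⟨0, by simp⟩

theorem WeightMod.pow {k : ℕ} {p : MvPolynomial σ K} (hp : WeightMod w N k p) (m : ℕ) :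
    WeightMod w N (k * m) (p ^ m) := by
  induction m with
  | zero => exact WeightMod.one
  | succ m ih => rw [pow_succ, Nat.mul_succ]; exact ih.mul hp

theorem WeightMod.prod {ι : Type*} {k : ι → ℕ} {p : ι → MvPolynomial σ K} (s : Finset ι)
    (hp : ∀ i, WeightMod w N (k i) (p i)) : WeightMod w N (∑ i ∈ s, k i) (∏ i ∈ s, p i) := by
  classical
  induction s using Finset.induction_on with
  | empty => exact WeightMod.one
  | insert i s hi ih => rw [Finset.sum_insert hi, Finset.prod_insert hi]; exact (hp i).mul ih

end WeightMod

section GradedHom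

variable [CommSemiring K] {w : σ → ℕ} {w' : τ → ℕ} {h : MvPolynomial σ K →ₐ[K] MvPolynomial τ K}

theorem isWeightedHomogeneous_map_monomial (hh : ∀ i, IsWeightedHomogeneous w' (h (X i)) (w i))
    (b : σ →₀ ℕ) (c : K) :
    IsWeightedHomogeneous w' (h (monomial b c)) (Finsupp.weight w b) := by
  rw [monomial_eq, map_mul, Finsupp.prod, map_prod, Finsupp.weight_apply, Finsupp.sum, algHom_C,
    algebraMap_eq]
  refine IsWeightedHomogeneous.C_mul (IsWeightedHomogeneous.prod _ _ _ fun i _ => ?_) c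
  rw [map_pow]
  exact (hh i).pow _

/-- A homomorphism that sends the variables to weighted homogeneous polynomials of the right
weights commutes with taking weighted homogeneous components. -/
theorem weightedHomogeneousComponent_map (hh : ∀ i, IsWeightedHomogeneous w' (h (X i)) (w i))
    (k : ℕ) (p : MvPolynomial σ K) :
    weightedHomogeneousComponent w' k (h p) = h (weightedHomogeneousComponent w k p) := by
  classical
  induction p using MvPolynomial.induction_on' with
  | add p q hp hq => simp only [map_add, hp, hq]
  | monomial b c =>
    rw [weightedHomogeneousComponent_of_mem (isWeightedHomogeneous_map_monomial hh b c),
      weightedHomogeneousComponent_of_mem (isWeightedHomogeneous_monomial w b c rfl)]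
    split_ifs <;> simp

theorem isWeightedHomogeneous_map (hh : ∀ i, IsWeightedHomogeneous w' (h (X i)) (w i))
    {k : ℕ} {p : MvPolynomial σ K} (hp : IsWeightedHomogeneous w p k) :
    IsWeightedHomogeneous w' (h p) k := by
  rw [← hp.weightedHomogeneousComponent_same, ← weightedHomogeneousComponent_map hh]
  exact weightedHomogeneousComponent_isWeightedHomogeneous ..

/-- An injective graded map reflects homogeneity: `p` and its component of weight `k` have the same
image. -/
theorem isWeightedHomogeneous_map_iff (hh : ∀ i, IsWeightedHomogeneous w' (h (X i)) (w i))
    (hinj : Function.Injective h) {k : ℕ} {p : MvPolynomial σ K} :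
    IsWeightedHomogeneous w' (h p) k ↔ IsWeightedHomogeneous w p k := by
  refine ⟨fun hp => ?_, isWeightedHomogeneous_map hh⟩
  have : weightedHomogeneousComponent w k p = p :=
    hinj (by rw [← weightedHomogeneousComponent_map hh, hp.weightedHomogeneousComponent_same])
  rw [← this]
  exact weightedHomogeneousComponent_isWeightedHomogeneous ..

end GradedHom

/-- Transport of structure, applied to both sides of (iv): each is a polynomial ring with variables
of weights `d`. -/
theorem gradedAlgebra_map_weightedHomogeneousSubmodule [CommRing K] {A : Type*} [CommRing A]
    [Algebra K A] (w : σ → ℕ) (e : MvPolynomial σ K ≃ₐ[K] A) (𝒜 : ℕ → Submodule K A)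
    (h : ∀ k, 𝒜 k = (weightedHomogeneousSubmodule K w k).map e.toLinearMap) :
    Nonempty (GradedAlgebra 𝒜) := by
  let _ := weightedGradedAlgebra K w
  have mem : ∀ {k a}, a ∈ 𝒜 k ↔ e.symm a ∈ weightedHomogeneousSubmodule K w k := by
    intro k a
    rw [h, Submodule.mem_map]
    refine ⟨?_, fun ha => ⟨_, ha, e.apply_symm_apply a⟩⟩
    rintro ⟨p, hp, rfl⟩
    simpa using hp
  have hint : DirectSum.IsInternal 𝒜 := by
    have h0 := (DirectSum.isInternal_submodule_iff_iSupIndep_and_iSup_eq_top _).mp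
      (DirectSum.Decomposition.isInternal (weightedHomogeneousSubmodule K w))
    rw [DirectSum.isInternal_submodule_iff_iSupIndep_and_iSup_eq_top]
    have e𝒜 : 𝒜 = (Submodule.orderIsoMapComap e.toLinearEquiv) ∘
        weightedHomogeneousSubmodule K w := by
      funext k
      rw [h]
      rfl
    rw [e𝒜]
    refine ⟨(iSupIndep_map_orderIso_iff _).mpr h0.1, ?_⟩
    have := (Submodule.orderIsoMapComap e.toLinearEquiv).map_iSup (weightedHomogeneousSubmodule K w)
    rw [h0.2, OrderIso.map_top] at this
    exact this.symm
  have : SetLike.GradedMonoid 𝒜 :=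
    { one_mem := by
        rw [mem, map_one]
        exact isWeightedHomogeneous_one K w
      mul_mem := by
        intro i j a b ha hb
        rw [mem] at *
        rw [map_mul]
        exact ha.mul hb }
  exact ⟨hint.gradedAlgebra⟩

/-- The polynomials lie in a polynomial ring in the variables `s`, whose transcendence degree is the
size of `s`. -/
theorem card_le_of_algebraicIndependent_of_supported {F ι : Type*} [Field F] [Fintype ι]
    {p : ι → MvPolynomial σ F} (hp : AlgebraicIndependent F p) (s : Finset σ)
    (hs : ∀ i, p i ∈ supported F (s : Set σ)) : Fintype.card ι ≤ s.card := by
  have h1 : AlgebraicIndependent F (fun i => (⟨p i, hs i⟩ : supported F (s : Set σ))) :=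
    AlgebraicIndependent.of_comp (supported F (s : Set σ)).val hp
  have h2 := (h1.map' (f := (supportedEquivMvPolynomial (R := F) (s : Set σ)).toAlgHom)
    (supportedEquivMvPolynomial (R := F) (s : Set σ)).injective).lift_cardinalMk_le_trdeg
  rw [MvPolynomial.trdeg_of_isDomain] at h2
  simpa using h2

/-- Weighted homogeneous polynomials of the weights of the variables generate the polynomial
algebra if the matrix of their linear coefficients is invertible. -/
theorem adjoin_eq_top_of_isUnit_linearPart {F : Type*} [Field F] [Fintype σ] [DecidableEq σ]
    {w : σ → ℕ} (hw : ∀ i, 0 < w i) {u : σ → MvPolynomial σ F}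
    (hu : ∀ i, IsWeightedHomogeneous w (u i) (w i))
    (hdet : IsUnit (Matrix.of fun i j => coeff (Finsupp.single j 1) (u i)).det) :
    Algebra.adjoin F (Set.range u) = ⊤ := by
  set L : Matrix σ σ F := Matrix.of fun i j => coeff (Finsupp.single j 1) (u i) with hL
  have hL0 : ∀ i j, w i ≠ w j → L i j = 0 := fun i j hij => by
    by_contra hne
    have := hu i hne
    rw [Finsupp.weight_single, one_smul] at this
    exact hij this.symm
  set S := Algebra.adjoin F (Set.range u)
  have huS : ∀ i, u i ∈ S := fun i => Algebra.subset_adjoin ⟨i, rfl⟩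
  have key : ∀ (k : ℕ) (j : σ), w j = k → X j ∈ S := by
    intro k
    induction k using Nat.strong_induction_on with
    | _ k ih =>
    intro j hj
    -- Weights being positive, each variable in a nonlinear monomial of weight `k` has weight below
    -- `k`, so the induction hypothesis covers it.
    have decomposable : ∀ p : MvPolynomial σ F, IsWeightedHomogeneous w p k →
        (∀ i, coeff (Finsupp.single i 1) p = 0) → p ∈ S := by
      intro p hp hlin
      rw [p.as_sum]
      refine Subalgebra.sum_mem _ fun b hb => ?_
      rw [MvPolynomial.mem_support_iff] at hb
      rw [monomial_eq]
      refine mul_mem (Subalgebra.algebraMap_mem S _) (Subalgebra.prod_mem _ fun i hi => ?_)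
      refine pow_mem (ih (w i) ?_ i rfl) _
      obtain ⟨b', rfl⟩ : ∃ b', b = b' + Finsupp.single i 1 :=
        ⟨b - Finsupp.single i 1, (tsub_add_cancel_of_le (Finsupp.single_le_iff.mpr
          (Nat.one_le_iff_ne_zero.mpr (Finsupp.mem_support_iff.mp hi)))).symm⟩
      have hb' : b' ≠ 0 := by
        rintro rfl
        rw [zero_add] at hb
        exact hb (hlin i)
      have hwt := hp hb
      rw [map_add, Finsupp.weight_single, one_smul] at hwt
      have : Finsupp.weight w b' ≠ 0 := by
        obtain ⟨m, hm⟩ := Finsupp.ne_iff.mp hb'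
        have := Finsupp.le_weight w (hw m).ne' b'
        have hm' : b' m ≠ 0 := hm
        omega
      omega
    -- Inverting `L` produces the linear part `X j`. Only the `u i` of weight `k` are kept, so that
    -- `y` is homogeneous; nothing is lost, since `L` vanishes between indices of different weights.
    set y := ∑ i ∈ Finset.univ.filter (fun i => w i = k), C (L⁻¹ j i) * u i with hy
    have hyS : y ∈ S := Subalgebra.sum_mem _ fun i _ =>
      mul_mem (Subalgebra.algebraMap_mem S _) (huS i)
    have hyk : IsWeightedHomogeneous w y k := IsWeightedHomogeneous.sum _ _ _ fun i hi =>
      ((Finset.mem_filter.mp hi).2 ▸ hu i).C_mul _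
    have hXk : IsWeightedHomogeneous w (X j : MvPolynomial σ F) k :=
      hj ▸ isWeightedHomogeneous_X F w j
    have hd : y - X j ∈ S := by
      refine decomposable _ (hyk.sub hXk) fun m => ?_
      have hyc : coeff (Finsupp.single m 1) y =
          ∑ i ∈ Finset.univ.filter (fun i => w i = k), L⁻¹ j i * L i m := by
        simp [hy, hL, coeff_sum, coeff_C_mul]
      have hsum : ∑ i, L⁻¹ j i * L i m = if j = m then 1 else 0 := by
        rw [← Matrix.mul_apply, Matrix.nonsing_inv_mul _ hdet, Matrix.one_apply]
      by_cases hm : w m = k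
      · have : ∑ i ∈ Finset.univ.filter (fun i => w i = k), L⁻¹ j i * L i m =
            ∑ i, L⁻¹ j i * L i m := by
          refine Finset.sum_subset (Finset.subset_univ _) fun i _ hi => ?_
          rw [hL0 i m (fun h => hi (by simp [h, hm])), mul_zero]
        rw [coeff_sub, hyc, this, hsum, coeff_X]
        simp [Finsupp.single_left_inj (one_ne_zero : (1 : ℕ) ≠ 0)]
      · by_contra hne
        have := (hyk.sub hXk) hne
        rw [Finsupp.weight_single, one_smul] at this
        exact hm this
    have := Subalgebra.sub_mem S hyS hd
    simpa using this
  rw [eq_top_iff, ← MvPolynomial.adjoin_range_X]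
  refine Algebra.adjoin_le ?_
  rintro _ ⟨j, rfl⟩
  exact key _ j rfl

/-- A generating family no larger than the transcendence degree is a transcendence basis. -/
theorem bijective_aeval_of_adjoin_eq_top {F : Type*} [Field F] [Finite σ]
    {u : σ → MvPolynomial σ F} (hu : Algebra.adjoin F (Set.range u) = ⊤) :
    Function.Bijective (aeval (R := F) u) := by
  constructor
  · have : Algebra.IsAlgebraic (Algebra.adjoin F (Set.range u)) (MvPolynomial σ F) := by
      rw [hu]
      exact ⟨fun p => isAlgebraic_algebraMap (⟨p, trivial⟩ : (⊤ : Subalgebra F (MvPolynomial σ F)))⟩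
    refine (Algebra.IsAlgebraic.isTranscendenceBasis_of_lift_le_trdeg_of_finite F u ?_).1
    rw [MvPolynomial.trdeg_of_isDomain]
    simp
  · rw [← AlgHom.range_eq_top, ← Algebra.adjoin_range_eq_range_aeval, hu]

end Polynomials

theorem wdeg_eq_weight {n : ℕ} (d : Fin n → ℕ) (b : Fin n →₀ ℕ) :
    wdeg d b = Finsupp.weight d b := by
  rw [wdeg, Finsupp.weight_eq_sum]
  exact Finset.sum_congr rfl fun i _ => by rw [smul_eq_mul, mul_comm]

/-- If a functional `e m` of the coefficients is shifted by each of the operators `D β`, then it is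
shifted by their products. -/
theorem shift_ofFn_prod {n : ℕ} {M K : Type*} [AddCommGroup M] [Module ℂ M]
    (D : Fin n → End ℂ M) (e : (Fin n →₀ ℕ) → M → K)
    (he : ∀ m β F, e m (D β F) = e (m + Finsupp.single β 1) F) (b m : Fin n →₀ ℕ) (F : M) :
    e m ((List.ofFn fun β => D β ^ b β).prod F) = e (m + b) F := by
  have hpow : ∀ (k : ℕ) (m β F), e m ((D β ^ k) F) = e (m + Finsupp.single β k) F := by
    intro k
    induction k with
    | zero => simp
    | succ k ih =>
      intro m β F
      rw [pow_succ, Module.End.mul_apply, ih, he, add_assoc, ← Finsupp.single_add]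
  have hlist : ∀ (l : List (Fin n)) (m F),
      e m ((l.map fun β => D β ^ b β).prod F) =
        e (m + (l.map fun β => Finsupp.single β (b β)).sum) F := by
    intro l
    induction l with
    | nil => simp
    | cons β l ih =>
      intro m F
      rw [List.map_cons, List.prod_cons, Module.End.mul_apply, hpow, ih, List.map_cons,
        List.sum_cons, add_assoc]
  rw [List.ofFn_eq_map, hlist, ← List.ofFn_eq_map, List.sum_ofFn, Finsupp.univ_sum_single]

/-! ### Translation by `q` and Taylor coefficients -/

section Translation

variable {V : Type*} [AddCommGroup V] [Module ℂ V] {n : ℕ}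

theorem polyAlg_algHom_ext {A : Type*} [CommRing A] [Algebra ℂ A] {f f' : PolyAlg V →ₐ[ℂ] A}
    (h : ∀ l : Dual ℂ V, f (lin l) = f' (lin l)) : f = f' :=
  SymmetricAlgebra.algHom_ext (LinearMap.ext h)

/-- The translation `(T_q F)(v) = F (q + v)`. -/
def translate (q : V) : PolyAlg V →ₐ[ℂ] PolyAlg V :=
  SymmetricAlgebra.lift (SymmetricAlgebra.ι ℂ (Dual ℂ V) +
    (Algebra.linearMap ℂ (PolyAlg V)).comp (Dual.eval ℂ V q))

@[simp]
theorem translate_lin (q : V) (l : Dual ℂ V) :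
    translate q (lin l) = lin l + algebraMap ℂ (PolyAlg V) (l q) := by
  simp [translate, SymmetricAlgebra.lift_ι_apply]

@[simp]
theorem evalAt_lin (q : V) (l : Dual ℂ V) : evalAt q (lin l) = l q := by
  simp [evalAt, SymmetricAlgebra.lift_ι_apply]

variable (z : Basis (Fin n) ℂ (Dual ℂ V))

/-- The identification of `ℂ[V]` with polynomials in the coordinates `z`. -/
abbrev coordEquiv : PolyAlg V ≃ₐ[ℂ] MvPolynomial (Fin n) ℂ := SymmetricAlgebra.equivMvPolynomial z

theorem coordEquiv_lin (l : Dual ℂ V) :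
    coordEquiv z (lin l) = ∑ β, C (z.repr l β) * X β := by
  have h : lin l = ∑ β, z.repr l β • lin (z β) := by
    simp only [lin, ← map_smul, ← map_sum, z.sum_repr]
  simp only [h, map_sum, map_smul, smul_eq_C_mul]
  simp

theorem coordEquiv_symm_monomial (b : Fin n →₀ ℕ) (c : ℂ) :
    (coordEquiv z).symm (monomial b c) = c • zpowMonomial z b := by
  rw [monomial_eq, map_mul, Finsupp.prod_fintype _ _ (by simp), map_prod, ← algebraMap_eq,
    AlgEquiv.commutes, zpowMonomial, Algebra.smul_def]
  simp

theorem coordEquiv_partialDeriv (β : Fin n) (F : PolyAlg V) :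
    coordEquiv z (partialDeriv z β F) = pderiv β (coordEquiv z F) := by
  simp [partialDeriv]

theorem partialDeriv_lin (β : Fin n) (l : Dual ℂ V) :
    partialDeriv z β (lin l) = algebraMap ℂ (PolyAlg V) (z.repr l β) := by
  apply (coordEquiv z).injective
  rw [coordEquiv_partialDeriv, coordEquiv_lin, AlgEquiv.commutes, map_sum]
  simp [pderiv_X, Pi.single_apply, algebraMap_eq]

theorem partialDeriv_mul (β : Fin n) (F F' : PolyAlg V) :
    partialDeriv z β (F * F') = partialDeriv z β F * F' + F * partialDeriv z β F' := by
  apply (coordEquiv z).injective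
  simp only [coordEquiv_partialDeriv, map_mul, map_add, pderiv_mul]

theorem partialDeriv_algebraMap (β : Fin n) (c : ℂ) :
    partialDeriv z β (algebraMap ℂ (PolyAlg V) c) = 0 := by
  apply (coordEquiv z).injective
  rw [coordEquiv_partialDeriv, AlgEquiv.commutes, algebraMap_eq, pderiv_C, map_zero]

theorem translate_partialDeriv (q : V) (β : Fin n) (F : PolyAlg V) :
    translate q (partialDeriv z β F) = partialDeriv z β (translate q F) := by
  induction F using SymmetricAlgebra.induction with
  | algebraMap c => rw [partialDeriv_algebraMap, AlgHom.commutes, partialDeriv_algebraMap, map_zero]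
  | ι l =>
    rw [← lin, partialDeriv_lin, translate_lin, map_add, partialDeriv_lin, partialDeriv_algebraMap,
      AlgHom.commutes, add_zero]
  | mul F F' h h' => simp only [partialDeriv_mul, map_mul, map_add, h, h']
  | add F F' h h' => simp only [map_add, h, h']

theorem constantCoeff_translate (q : V) (F : PolyAlg V) :
    coeff 0 (coordEquiv z (translate q F)) = evalAt q F := by
  have : ((aeval (fun _ : Fin n => (0 : ℂ))).comp (coordEquiv z).toAlgHom).comp (translate q) =
      evalAt q := by
    refine polyAlg_algHom_ext fun l => ?_
    simp [coordEquiv_lin, -SymmetricAlgebra.equivMvPolynomial_ι_apply]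
  rw [← this]
  simp [← constantCoeff_eq]

theorem coeff_translate_partialDeriv (q : V) (m : Fin n →₀ ℕ) (β : Fin n) (F : PolyAlg V) :
    coeff m (coordEquiv z (translate q (partialDeriv z β F))) =
      coeff (m + Finsupp.single β 1) (coordEquiv z (translate q F)) * (m β + 1) := by
  rw [translate_partialDeriv, coordEquiv_partialDeriv, MvPolynomial.coeff_pderiv]

/-- The factor `m!` absorbs the integer produced by differentiation, so that `∂/∂z^β` becomes a pure
shift of the exponent, as `shift_ofFn_prod` requires. -/
theorem factorial_mul_coeff_translate_partialDeriv (q : V) (m : Fin n →₀ ℕ) (β : Fin n)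
    (F : PolyAlg V) :
    ((∏ i, (m i).factorial : ℕ) : ℂ) *
        coeff m (coordEquiv z (translate q (partialDeriv z β F))) =
      ((∏ i, ((m + Finsupp.single β 1 : Fin n →₀ ℕ) i).factorial : ℕ) : ℂ) *
        coeff (m + Finsupp.single β 1) (coordEquiv z (translate q F)) := by
  have : ∏ i, ((m + Finsupp.single β 1 : Fin n →₀ ℕ) i).factorial =
      (∏ i, (m i).factorial) * (m β + 1) := by
    rw [← Finset.mul_prod_erase _ _ (Finset.mem_univ β),
      ← Finset.mul_prod_erase Finset.univ (fun i => (m i).factorial) (Finset.mem_univ β)]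
    have h1 : ∏ i ∈ Finset.univ.erase β, ((m + Finsupp.single β 1 : Fin n →₀ ℕ) i).factorial =
        ∏ i ∈ Finset.univ.erase β, (m i).factorial := by
      refine Finset.prod_congr rfl fun i hi => ?_
      simp [Finsupp.single_eq_of_ne (Finset.ne_of_mem_erase hi)]
    rw [h1]
    simp [Nat.factorial_succ]
    ring
  rw [coeff_translate_partialDeriv, this]
  push_cast
  ring

/-- Taylor's formula: start from the constant coefficient, which is evaluation at `q`, and shift by
`b`. -/
theorem taylorCoeff_eq {G : Subgroup (V ≃ₗ[ℂ] V)} (x : Fin n → invariants G) (q : V)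
    (a b : Fin n →₀ ℕ) :
    taylorCoeff x z q a b = coeff b (coordEquiv z (translate q (shiftedMonomial x q a))) := by
  have h := shift_ofFn_prod (partialDeriv z)
    (fun m F => ((∏ i, (m i).factorial : ℕ) : ℂ) * coeff m (coordEquiv z (translate q F)))
    (factorial_mul_coeff_translate_partialDeriv z q) b 0 (shiftedMonomial x q a)
  rw [← multiDeriv, constantCoeff_translate, zero_add] at h
  have hne : ((∏ i, (b i).factorial : ℕ) : ℂ) ≠ 0 :=
    Nat.cast_ne_zero.mpr (Finset.prod_ne_zero_iff.mpr fun i _ => Nat.factorial_ne_zero _)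
  simp only [Finsupp.coe_zero, Pi.zero_apply, Nat.factorial_zero, Finset.prod_const_one,
    Nat.cast_one, one_mul] at h
  rw [taylorCoeff, h]
  field_simp

theorem finsum_coeff_smul_zpowMonomial (F : PolyAlg V) :
    ∑ᶠ b : Fin n →₀ ℕ, coeff b (coordEquiv z F) • zpowMonomial z b = F := by
  rw [finsum_eq_sum_of_support_subset (s := (coordEquiv z F).support)]
  · simp only [← coordEquiv_symm_monomial, ← map_sum, support_sum_monomial_coeff,
      AlgEquiv.symm_apply_apply]
  · intro b hb
    simp only [Function.mem_support] at hb
    simp only [Finset.mem_coe, MvPolynomial.mem_support_iff]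
    exact fun h => hb (by rw [h, zero_smul])

theorem finsum_coeff_smul_zpowMonomial_of_wdeg (d : Fin n → ℕ) (k : ℕ) (F : PolyAlg V) :
    ∑ᶠ (b : Fin n →₀ ℕ) (_ : wdeg d b = k), coeff b (coordEquiv z F) • zpowMonomial z b =
      (coordEquiv z).symm (weightedHomogeneousComponent d k (coordEquiv z F)) := by
  classical
  rw [← finsum_coeff_smul_zpowMonomial z
    ((coordEquiv z).symm (weightedHomogeneousComponent d k (coordEquiv z F)))]
  refine finsum_congr fun b => ?_
  rw [AlgEquiv.apply_symm_apply, coeff_weightedHomogeneousComponent, finsum_eq_if, wdeg_eq_weight]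
  split_ifs <;> simp

end Translation

variable {V : Type*} [AddCommGroup V] [Module ℂ V] {n : ℕ}

/-! ### The two gradings of `ℂ[V]` in coordinates -/

section Homogeneous

variable (z : Basis (Fin n) ℂ (Dual ℂ V))

theorem map_coordEquiv_homogeneousPart (j : ℕ) :
    (homogeneousPart V j).map (coordEquiv z).toAlgHom.toLinearMap =
      homogeneousSubmodule (Fin n) ℂ j := by
  rw [homogeneousPart, Submodule.map_pow, ← homogeneousSubmodule_one_pow]
  congr 1
  rw [LinearMap.range_eq_map, ← z.span_eq, Submodule.map_span, Submodule.map_span,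
    homogeneousSubmodule_one_eq_span_X, ← Set.range_comp, ← Set.range_comp]
  congr 2
  ext1 i
  simp

theorem mem_homogeneousPart_iff {j : ℕ} {F : PolyAlg V} :
    F ∈ homogeneousPart V j ↔ (coordEquiv z F).IsHomogeneous j := by
  rw [← mem_homogeneousSubmodule, ← map_coordEquiv_homogeneousPart z]
  refine ⟨fun h => ⟨F, h, rfl⟩, ?_⟩
  rintro ⟨F', hF', h⟩
  exact (coordEquiv z).injective h ▸ hF'

theorem weightedPart_eq_map (d : Fin n → ℕ) (j : ℕ) :
    weightedPart d z j =
      (weightedHomogeneousSubmodule ℂ d j).map (coordEquiv z).symm.toLinearMap := by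
  apply le_antisymm
  · rw [weightedPart, Submodule.span_le]
    rintro _ ⟨b, rfl, rfl⟩
    refine ⟨monomial b 1, isWeightedHomogeneous_monomial _ _ _ (wdeg_eq_weight d b).symm, ?_⟩
    rw [AlgEquiv.toLinearMap_apply, coordEquiv_symm_monomial, one_smul]
  · rintro _ ⟨p, hp, rfl⟩
    rw [p.as_sum, map_sum]
    refine Submodule.sum_mem _ fun b hb => ?_
    rw [AlgEquiv.toLinearMap_apply, coordEquiv_symm_monomial]
    exact Submodule.smul_mem _ _ (Submodule.subset_span
      ⟨b, (wdeg_eq_weight d b).trans (hp (MvPolynomial.mem_support_iff.mp hb)), rfl⟩)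

theorem mem_weightedPart_iff {d : Fin n → ℕ} {j : ℕ} {F : PolyAlg V} :
    F ∈ weightedPart d z j ↔ IsWeightedHomogeneous d (coordEquiv z F) j := by
  rw [weightedPart_eq_map, Submodule.mem_map]
  refine ⟨?_, fun h => ⟨_, h, (coordEquiv z).symm_apply_apply F⟩⟩
  rintro ⟨p, hp, rfl⟩
  simpa using hp

theorem zpowMonomial_mem_weightedPart (d : Fin n → ℕ) (b : Fin n →₀ ℕ) :
    zpowMonomial z b ∈ weightedPart d z (Finsupp.weight d b) :=
  Submodule.subset_span ⟨b, wdeg_eq_weight d b, rfl⟩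

end Homogeneous

/-! ### The pullback along `ζ g⁻¹`, which fixes `q` -/

section Twist

/-- The algebra endomorphism with `l ↦ ζ (l ∘ g⁻¹)` for `l ∈ V*`. -/
def twist (g : V ≃ₗ[ℂ] V) (ζ : ℂ) : PolyAlg V →ₐ[ℂ] PolyAlg V :=
  SymmetricAlgebra.lift
    (ζ • (SymmetricAlgebra.ι ℂ (Dual ℂ V)).comp (g⁻¹ : V ≃ₗ[ℂ] V).toLinearMap.dualMap)

variable {g : V ≃ₗ[ℂ] V} {ζ : ℂ}

theorem twist_lin (l : Dual ℂ V) : twist g ζ (lin l) = ζ • act g (lin l) := by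
  simp [twist, act, SymmetricAlgebra.lift_ι_apply]

theorem act_lin (l : Dual ℂ V) :
    act g (lin l) = lin (l.comp (g⁻¹ : V ≃ₗ[ℂ] V).toLinearMap) := by
  simp [act, SymmetricAlgebra.lift_ι_apply, LinearMap.dualMap_apply']

theorem twist_lin' (l : Dual ℂ V) :
    twist g ζ (lin l) = lin (ζ • l.comp (g⁻¹ : V ≃ₗ[ℂ] V).toLinearMap) := by
  rw [twist_lin, act_lin, lin, lin, map_smul]

theorem apply_inv_eigenvector {q : V} (hq : g q = ζ • q) (l : Dual ℂ V) :
    ζ * l ((g⁻¹ : V ≃ₗ[ℂ] V) q) = l q := by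
  have : ζ • (g⁻¹ : V ≃ₗ[ℂ] V) q = q := by
    rw [← map_smul, ← hq]
    exact g.symm_apply_apply q
  rw [← smul_eq_mul, ← map_smul, this]

theorem twist_translate {q : V} (hq : g q = ζ • q) (F : PolyAlg V) :
    twist g ζ (translate q F) = translate q (twist g ζ F) := by
  have : (twist g ζ).comp (translate q) = (translate q).comp (twist g ζ) := by
    refine polyAlg_algHom_ext fun l => ?_
    simp only [AlgHom.comp_apply, translate_lin, map_add, AlgHom.commutes, twist_lin']
    congr 2
    exact (apply_inv_eigenvector hq l).symm
  exact DFunLike.congr_fun this F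

theorem evalAt_twist {q : V} (hq : g q = ζ • q) (F : PolyAlg V) :
    evalAt q (twist g ζ F) = evalAt q F := by
  have : (evalAt q).comp (twist g ζ) = evalAt q := by
    refine polyAlg_algHom_ext fun l => ?_
    rw [AlgHom.comp_apply, twist_lin', evalAt_lin, evalAt_lin]
    exact apply_inv_eigenvector hq l
  exact DFunLike.congr_fun this F

theorem twist_eq_smul_act {k : ℕ} {F : PolyAlg V} (hF : F ∈ homogeneousPart V k) :
    twist g ζ F = ζ ^ k • act g F := by
  induction hF using Submodule.pow_induction_on_left' with
  | algebraMap r => simp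
  | add x y i hx hy h h' => rw [map_add, map_add, h, h', smul_add]
  | mem_mul m hm i x hx h =>
    obtain ⟨l, rfl⟩ := hm
    rw [map_mul, map_mul, h, ← lin, twist_lin, smul_mul_smul_comm, pow_succ']

theorem twist_eq_of_act_eq {k : ℕ} {F : PolyAlg V} (hF : F ∈ homogeneousPart V k)
    (hact : act g F = F) : twist g ζ F = ζ ^ k • F := by
  rw [twist_eq_smul_act hF, hact]

/-- Adapted coordinates diagonalize the twist: the extra factor `ζ` turns the eigenvalue `ζ^(d_α -
1)` of `z^α` into `ζ^(d_α)`, so the weight `d·b` can be read modulo the order of `ζ`. -/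
theorem coeff_twist {d : Fin n → ℕ} {z : Basis (Fin n) ℂ (Dual ℂ V)} (hζ : ζ ≠ 0)
    (hz : IsAdapted d g ζ z) (b : Fin n →₀ ℕ) (F : PolyAlg V) :
    coeff b (coordEquiv z (twist g ζ F)) = ζ ^ Finsupp.weight d b * coeff b (coordEquiv z F) := by
  classical
  have hX : ∀ α, coordEquiv z (twist g ζ (lin (z α))) = C (ζ ^ d α) * X α := by
    intro α
    rw [twist_lin, hz α, smul_smul, ← zpow_one_add₀ hζ, add_sub_cancel, zpow_natCast, map_smul,
      smul_eq_C_mul]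
    simp
  obtain ⟨p, rfl⟩ := (coordEquiv z).symm.surjective F
  rw [AlgEquiv.apply_symm_apply]
  induction p using MvPolynomial.induction_on' with
  | add p q hp hq => simp only [map_add, coeff_add, hp, hq, mul_add]
  | monomial m c =>
    have : coordEquiv z (twist g ζ ((coordEquiv z).symm (monomial m c))) =
        monomial m (ζ ^ Finsupp.weight d m * c) := by
      rw [coordEquiv_symm_monomial, map_smul, map_smul, zpowMonomial, map_prod, map_prod]
      simp_rw [map_pow, hX, mul_pow]
      rw [Finset.prod_mul_distrib, smul_eq_C_mul, monomial_eq,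
        Finsupp.prod_fintype _ _ (by simp), ← mul_assoc, Finsupp.weight_eq_sum,
        ← Finset.prod_pow_eq_pow_sum]
      simp_rw [smul_eq_mul, mul_comm (m _) (d _), pow_mul, ← map_pow, ← map_prod]
      rw [← C_mul, mul_comm c]
    rw [this, coeff_monomial, coeff_monomial]
    split_ifs with h
    · rw [h]
    · rw [mul_zero]

theorem pow_weight_eq_of_coeff_ne_zero {d : Fin n → ℕ} {z : Basis (Fin n) ℂ (Dual ℂ V)}
    (hζ : ζ ≠ 0) (hz : IsAdapted d g ζ z) {k : ℕ} {F : PolyAlg V} (hF : twist g ζ F = ζ ^ k • F)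
    {b : Fin n →₀ ℕ} (hb : coeff b (coordEquiv z F) ≠ 0) : ζ ^ Finsupp.weight d b = ζ ^ k := by
  have := coeff_twist hζ hz b F
  rw [hF, map_smul, coeff_smul, smul_eq_mul] at this
  exact (mul_right_cancel₀ hb this).symm

theorem evalAt_eq_zero_of_pow_ne_one {q : V} (hq : g q = ζ • q) {k : ℕ} {F : PolyAlg V}
    (hF : twist g ζ F = ζ ^ k • F) (hk : ζ ^ k ≠ 1) : evalAt q F = 0 := by
  have := evalAt_twist hq F
  rw [hF, map_smul, smul_eq_mul] at this
  by_contra h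
  exact hk (mul_right_cancel₀ h (by rw [this, one_mul]))

end Twist

/-! ### Basic invariants, their degrees, and the maps `φ` and `ψ` -/

section BasicInvariants

variable {G : Subgroup (V ≃ₗ[ℂ] V)} {d : Fin n → ℕ} {x : Fin n → invariants G}

/-- `ℂ[V]^G` is the polynomial algebra in the basic invariants. -/
def IsBasicInvariants.equiv (hx : IsBasicInvariants G d x) :
    MvPolynomial (Fin n) ℂ ≃ₐ[ℂ] invariants G :=
  AlgEquiv.ofBijective (MvPolynomial.aeval x) ⟨hx.algebraicIndependent, by
    rw [← AlgHom.range_eq_top, ← Algebra.adjoin_range_eq_range_aeval, hx.generate]⟩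

theorem IsBasicInvariants.equiv_apply (hx : IsBasicInvariants G d x)
    (p : MvPolynomial (Fin n) ℂ) : hx.equiv p = aeval x p := rfl

@[simp]
theorem IsBasicInvariants.equiv_X (hx : IsBasicInvariants G d x) (α : Fin n) :
    hx.equiv (X α) = x α := by
  rw [hx.equiv_apply, aeval_X]

@[simp]
theorem IsBasicInvariants.equiv_symm_apply (hx : IsBasicInvariants G d x) (α : Fin n) :
    hx.equiv.symm (x α) = X α := by
  rw [AlgEquiv.symm_apply_eq, hx.equiv_X]

theorem IsBasicInvariants.algHom_ext (hx : IsBasicInvariants G d x) {A : Type*} [CommRing A]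
    [Algebra ℂ A] {f f' : invariants G →ₐ[ℂ] A} (h : ∀ α, f (x α) = f' (x α)) : f = f' := by
  have : f.comp hx.equiv.toAlgHom = f'.comp hx.equiv.toAlgHom :=
    MvPolynomial.algHom_ext fun α => by simp [h]
  ext y
  obtain ⟨p, rfl⟩ := hx.equiv.surjective y
  exact DFunLike.congr_fun this p

theorem IsBasicInvariants.coordEquiv_homogeneous (hx : IsBasicInvariants G d x)
    (z : Basis (Fin n) ℂ (Dual ℂ V)) (α : Fin n) :
    (coordEquiv z (x α : PolyAlg V)).IsHomogeneous (d α) :=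
  (mem_homogeneousPart_iff z).mp (hx.homogeneous α)

theorem IsBasicInvariants.mem_invariantPart_iff (hx : IsBasicInvariants G d x)
    (z : Basis (Fin n) ℂ (Dual ℂ V)) {k : ℕ} {F : invariants G} :
    F ∈ invariantPart G k ↔ IsWeightedHomogeneous d (hx.equiv.symm F) k := by
  let h : MvPolynomial (Fin n) ℂ →ₐ[ℂ] MvPolynomial (Fin n) ℂ :=
    ((coordEquiv z).toAlgHom.comp (invariants G).val).comp hx.equiv.toAlgHom
  have hh : ∀ α, IsWeightedHomogeneous (1 : Fin n → ℕ) (h (X α)) (d α) := fun α => by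
    have : h (X α) = coordEquiv z (x α : PolyAlg V) := by simp [h]
    rw [this]
    exact hx.coordEquiv_homogeneous z α
  have hinj : Function.Injective h :=
    (coordEquiv z).injective.comp (Subtype.val_injective.comp hx.equiv.injective)
  rw [← isWeightedHomogeneous_map_iff hh hinj]
  have : h (hx.equiv.symm F) = coordEquiv z (F : PolyAlg V) := by simp [h]
  rw [this]
  exact mem_homogeneousPart_iff z

theorem IsBasicInvariants.invariantPart_eq_map (hx : IsBasicInvariants G d x)
    (z : Basis (Fin n) ℂ (Dual ℂ V)) (k : ℕ) :
    invariantPart G k = (weightedHomogeneousSubmodule ℂ d k).map hx.equiv.toLinearMap := by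
  ext F
  rw [hx.mem_invariantPart_iff z, Submodule.mem_map]
  refine ⟨fun h => ⟨_, h, hx.equiv.apply_symm_apply F⟩, ?_⟩
  rintro ⟨p, hp, rfl⟩
  simpa using hp

theorem IsBasicInvariants.equiv_monomial (hx : IsBasicInvariants G d x) (a : Fin n →₀ ℕ) (c : ℂ) :
    hx.equiv (monomial a c) = c • hx.monomialBasis a := by
  rw [hx.monomialBasis_apply, hx.equiv_apply, aeval_monomial,
    Finsupp.prod_fintype _ _ (by simp), Algebra.smul_def]

theorem IsBasicInvariants.invariantPart_eq_span (hx : IsBasicInvariants G d x)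
    (z : Basis (Fin n) ℂ (Dual ℂ V)) (k : ℕ) :
    invariantPart G k =
      Submodule.span ℂ (hx.monomialBasis '' {a | Finsupp.weight d a = k}) := by
  rw [hx.invariantPart_eq_map z]
  apply le_antisymm
  · rintro _ ⟨p, hp, rfl⟩
    rw [p.as_sum, map_sum]
    refine Submodule.sum_mem _ fun a ha => ?_
    rw [AlgEquiv.toLinearMap_apply, hx.equiv_monomial]
    exact Submodule.smul_mem _ _
      (Submodule.subset_span ⟨a, hp (MvPolynomial.mem_support_iff.mp ha), rfl⟩)
  · rw [Submodule.span_le]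
    rintro _ ⟨a, rfl, rfl⟩
    refine ⟨monomial a 1, isWeightedHomogeneous_monomial _ _ _ rfl, ?_⟩
    rw [AlgEquiv.toLinearMap_apply, hx.equiv_monomial, one_smul]

/-- An element of degree `0` is a constant, which a variable of a polynomial ring is not. -/
theorem IsBasicInvariants.degree_pos (hx : IsBasicInvariants G d x) (α : Fin n) : 0 < d α := by
  by_contra h
  have h0 : d α = 0 := by omega
  have hα : (x α : PolyAlg V) ∈ homogeneousPart V 0 := h0 ▸ hx.homogeneous α
  rw [homogeneousPart, pow_zero, Submodule.mem_one] at hα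
  obtain ⟨c, hc⟩ := hα
  have hc' : x α = algebraMap ℂ (invariants G) c := Subtype.ext hc.symm
  have := hx.equiv_symm_apply α
  rw [hc', AlgEquiv.commutes, algebraMap_eq] at this
  have h1 := congrArg (coeff (Finsupp.single α 1)) this
  rw [coeff_C, coeff_X, if_neg (Finsupp.single_ne_zero.mpr one_ne_zero).symm] at h1
  simp at h1

/-- If `d' k < d k`, all `x' j` with `j ≤ k` have degree below `d k`, so they are polynomials in the
`x β` with `β < k` alone: too many independent elements in too few variables. -/
theorem IsBasicInvariants.degree_le (hx : IsBasicInvariants G d x) {d' : Fin n → ℕ}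
    {x' : Fin n → invariants G} (hx' : IsBasicInvariants G d' x')
    (z : Basis (Fin n) ℂ (Dual ℂ V)) : d ≤ d' := by
  intro k
  by_contra hle
  have hlt : d' k < d k := not_le.mp hle
  have hind : AlgebraicIndependent ℂ
      (fun j : Set.Iic k => hx.equiv.symm (x' j)) :=
    (hx'.algebraicIndependent.comp _ Subtype.val_injective).map' (f := hx.equiv.symm.toAlgHom)
      hx.equiv.symm.injective
  have hsupp : ∀ j : Set.Iic k,
      hx.equiv.symm (x' j) ∈ supported ℂ ((Finset.Iio k : Finset (Fin n)) : Set (Fin n)) := by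
    rintro ⟨j, hj⟩
    rw [mem_supported]
    intro β hβ
    rw [Finset.coe_Iio, Set.mem_Iio]
    by_contra! hkβ
    rw [Finset.mem_coe, MvPolynomial.mem_vars_iff_mem_support] at hβ
    obtain ⟨b, hb, hβb⟩ := hβ
    have hw := (hx.mem_invariantPart_iff z).mp (hx'.homogeneous j)
      (MvPolynomial.mem_support_iff.mp hb)
    have h1 := Finsupp.le_weight_of_ne_zero' d (Finsupp.mem_support_iff.mp hβb)
    have h2 := hx.monotone hkβ
    have h3 : d' j ≤ d' k := hx'.monotone hj
    omega
  have := card_le_of_algebraicIndependent_of_supported hind _ hsupp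
  simp at this

theorem IsBasicInvariants.degree_eq (hx : IsBasicInvariants G d x) {d' : Fin n → ℕ}
    {x' : Fin n → invariants G} (hx' : IsBasicInvariants G d' x')
    (z : Basis (Fin n) ℂ (Dual ℂ V)) : d' = d :=
  le_antisymm (hx'.degree_le hx z) (hx.degree_le hx' z)

/-- The algebra homomorphism `x^α ↦ T_q (x^α - x^α(q))`. -/
def IsBasicInvariants.taylorHom (hx : IsBasicInvariants G d x) (q : V) :
    invariants G →ₐ[ℂ] PolyAlg V :=
  (aeval fun α => translate q (x α : PolyAlg V) -
    algebraMap ℂ (PolyAlg V) (evalAt q (x α : PolyAlg V))).comp hx.equiv.symm.toAlgHom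

@[simp]
theorem IsBasicInvariants.taylorHom_apply (hx : IsBasicInvariants G d x) (q : V) (α : Fin n) :
    hx.taylorHom q (x α) = translate q (x α : PolyAlg V) -
      algebraMap ℂ (PolyAlg V) (evalAt q (x α : PolyAlg V)) := by
  simp [taylorHom]

theorem IsBasicInvariants.taylorHom_monomialBasis (hx : IsBasicInvariants G d x) (q : V)
    (a : Fin n →₀ ℕ) :
    hx.taylorHom q (hx.monomialBasis a) = translate q (shiftedMonomial x q a) := by
  simp [hx.monomialBasis_apply, shiftedMonomial]

theorem IsBasicInvariants.taylorMap_eq (hx : IsBasicInvariants G d x)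
    (z : Basis (Fin n) ℂ (Dual ℂ V)) (q : V) :
    taylorMap hx z q = (hx.taylorHom q).toLinearMap := by
  refine hx.monomialBasis.ext fun a => ?_
  rw [taylorMap, Basis.constr_basis, AlgHom.toLinearMap_apply, hx.taylorHom_monomialBasis]
  simp_rw [taylorCoeff_eq]
  exact finsum_coeff_smul_zpowMonomial z _

theorem IsBasicInvariants.truncatedTaylorMap_monomialBasis (hx : IsBasicInvariants G d x)
    (z : Basis (Fin n) ℂ (Dual ℂ V)) (q : V) (a : Fin n →₀ ℕ) :
    truncatedTaylorMap hx z q (hx.monomialBasis a) =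
      (coordEquiv z).symm (weightedHomogeneousComponent d (Finsupp.weight d a)
        (coordEquiv z (hx.taylorHom q (hx.monomialBasis a)))) := by
  rw [truncatedTaylorMap, Basis.constr_basis, hx.taylorHom_monomialBasis]
  simp_rw [taylorCoeff_eq]
  rw [finsum_coeff_smul_zpowMonomial_of_wdeg, wdeg_eq_weight]

/-- Describes `ψ` on each `S(k)` through `φ` alone, without the monomials `x^a`; this is what makes
a comparison of different basic invariants possible. -/
theorem IsBasicInvariants.truncatedTaylorMap_of_mem (hx : IsBasicInvariants G d x)
    (z : Basis (Fin n) ℂ (Dual ℂ V)) (q : V) {k : ℕ} {F : invariants G}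
    (hF : F ∈ invariantPart G k) :
    truncatedTaylorMap hx z q F =
      (coordEquiv z).symm (weightedHomogeneousComponent d k (coordEquiv z (hx.taylorHom q F))) := by
  rw [hx.invariantPart_eq_span z] at hF
  induction hF using Submodule.span_induction with
  | mem F h => obtain ⟨a, rfl, rfl⟩ := h; exact hx.truncatedTaylorMap_monomialBasis z q a
  | zero => simp
  | add F F' _ _ h h' => simp only [map_add, h, h']
  | smul c F _ h => simp only [map_smul, h]

end BasicInvariants

variable {G : Subgroup (V ≃ₗ[ℂ] V)} {d : Fin n → ℕ} {x : Fin n → invariants G}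

/-! ### The Jacobian matrix and change of coordinates -/

section Jacobian

theorem jacobianAt_apply (x : Fin n → invariants G) (z : Basis (Fin n) ℂ (Dual ℂ V)) (q : V)
    (α β : Fin n) :
    jacobianAt x z q α β =
      coeff (Finsupp.single β 1) (coordEquiv z (translate q (x α : PolyAlg V))) := by
  rw [jacobianAt, Matrix.of_apply, ← constantCoeff_translate z, coeff_translate_partialDeriv]
  simp

/-- The chain rule for a linear change of coordinates. -/
theorem evalAt_partialDeriv_change (z z' : Basis (Fin n) ℂ (Dual ℂ V)) (q : V) (γ : Fin n)
    (F : PolyAlg V) :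
    evalAt q (partialDeriv z' γ F) =
      ∑ β, evalAt q (partialDeriv z β F) * z'.repr (z β) γ := by
  induction F using SymmetricAlgebra.induction with
  | algebraMap c => simp only [partialDeriv_algebraMap, map_zero, zero_mul, Finset.sum_const_zero]
  | ι l =>
    rw [← lin]
    simp_rw [partialDeriv_lin, AlgHom.commutes, Algebra.algebraMap_self, RingHom.id_apply]
    have hl : z'.repr l = ∑ β, z.repr l β • z'.repr (z β) := by
      simp only [← map_smul, ← map_sum, z.sum_repr]
    rw [hl, Finsupp.finsetSum_apply]
    rfl
  | mul F F' h h' =>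
    simp only [partialDeriv_mul, map_add, map_mul, h, h', Finset.sum_mul, Finset.mul_sum,
      ← Finset.sum_add_distrib]
    exact Finset.sum_congr rfl fun _ _ => by ring
  | add F F' h h' => simp only [map_add, h, h', add_mul, Finset.sum_add_distrib]

theorem isUnit_det_jacobianAt {z' : Basis (Fin n) ℂ (Dual ℂ V)} {q : V}
    (h : IsUnit (jacobianAt x z' q).det) (z : Basis (Fin n) ℂ (Dual ℂ V)) :
    IsUnit (jacobianAt x z q).det := by
  have : jacobianAt x z' q =
      jacobianAt x z q * Matrix.of fun β γ => z'.repr (z β) γ := by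
    ext α γ
    rw [Matrix.mul_apply]
    exact evalAt_partialDeriv_change z z' q γ _
  rw [this, Matrix.det_mul] at h
  exact isUnit_of_mul_isUnit_left h

end Jacobian

/-! ### Invariants at the eigenvector `q`, and independence of `φ` from the basic invariants -/

theorem le_topDegree (d : Fin n → ℕ) (α : Fin n) : d α ≤ topDegree d :=
  Finset.le_sup (f := d) (Finset.mem_univ α)

theorem twist_invariant {g : V ≃ₗ[ℂ] V} (hg : g ∈ G) (ζ : ℂ) {k : ℕ} {F : invariants G}
    (hF : F ∈ invariantPart G k) : twist g ζ (F : PolyAlg V) = ζ ^ k • (F : PolyAlg V) :=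
  twist_eq_of_act_eq hF ((mem_invariants G _).mp F.2 g hg)

/-- Exponents congruent modulo `N`, the smaller one in `[1, N]`. -/
theorem exists_add_mul_of_pow_eq {ζ : ℂ} {N k m : ℕ} (hζ : IsPrimitiveRoot ζ N) (hkN : k ≤ N)
    (hk : 0 < k) (hm : 0 < m) (h : ζ ^ m = ζ ^ k) : ∃ j, m = k + N * j := by
  have hζ0 : ζ ≠ 0 := hζ.ne_zero (by omega)
  have hdvd : (N : ℤ) ∣ (m : ℤ) - k := by
    rw [← hζ.zpow_eq_one_iff_dvd, zpow_sub₀ hζ0, zpow_natCast, zpow_natCast, h,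
      div_self (pow_ne_zero _ hζ0)]
  obtain ⟨c, hc⟩ := hdvd
  -- A negative `c` would give `m ≤ k - N ≤ 0`.
  have hc0 : 0 ≤ c := by
    by_contra! hneg
    nlinarith
  obtain ⟨j, rfl⟩ := Int.eq_ofNat_of_zero_le hc0
  exact ⟨j, by zify; linarith⟩

theorem eq_of_pow_eq {ζ : ℂ} {N k m : ℕ} (hζ : IsPrimitiveRoot ζ N) (hkN : k ≤ N)
    (hk : 0 < k) (hmN : m ≤ N) (hm : 0 < m) (h : ζ ^ m = ζ ^ k) : m = k := by
  obtain ⟨i, hi⟩ := exists_add_mul_of_pow_eq hζ hkN hk hm h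
  obtain ⟨j, hj⟩ := exists_add_mul_of_pow_eq hζ hmN hm hk h.symm
  have h1 : k ≤ m := hi ▸ Nat.le_add_right _ _
  have h2 : m ≤ k := hj ▸ Nat.le_add_right _ _
  omega

/-- The part of admissibility used in the Taylor expansions. -/
structure IsRegularEigenvector (G : Subgroup (V ≃ₗ[ℂ] V)) (d : Fin n → ℕ) (g : V ≃ₗ[ℂ] V) (ζ : ℂ)
    (q : V) : Prop where
  mem : g ∈ G
  apply_eq : g q = ζ • q
  primitive : IsPrimitiveRoot ζ (topDegree d)
  topDegree_pos : 0 < topDegree d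

variable {g : V ≃ₗ[ℂ] V} {ζ : ℂ} {q : V}

theorem IsRegularEigenvector.ne_zero (h : IsRegularEigenvector G d g ζ q) : ζ ≠ 0 :=
  h.primitive.ne_zero h.topDegree_pos.ne'

theorem IsRegularEigenvector.evalAt_eq_zero (h : IsRegularEigenvector G d g ζ q) {k : ℕ}
    (hk : 0 < k) (hkN : k < topDegree d) {F : invariants G} (hF : F ∈ invariantPart G k) :
    evalAt q (F : PolyAlg V) = 0 :=
  evalAt_eq_zero_of_pow_ne_one h.apply_eq (twist_invariant h.mem ζ hF)
    (h.primitive.pow_ne_one_of_pos_of_lt hk.ne' hkN)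

/-- On invariants of degree at most the highest one, the Taylor homomorphism is
`F ↦ T_q F - F(q)`. -/
theorem IsRegularEigenvector.taylorHom_of_mem (h : IsRegularEigenvector G d g ζ q)
    (hx : IsBasicInvariants G d x) (z : Basis (Fin n) ℂ (Dual ℂ V)) {k : ℕ} (hk : 0 < k)
    (hkN : k ≤ topDegree d) {F : invariants G} (hF : F ∈ invariantPart G k) :
    hx.taylorHom q F = translate q (F : PolyAlg V) -
      algebraMap ℂ (PolyAlg V) (evalAt q (F : PolyAlg V)) := by
  rw [hx.invariantPart_eq_span z] at hF
  induction hF using Submodule.span_induction with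
  | zero => simp
  | add F F' _ _ h h' => simp only [Subalgebra.coe_add, map_add, h, h']; ring
  | smul c F _ h =>
    rw [map_smul, h, Subalgebra.coe_smul, map_smul, map_smul, smul_sub, smul_eq_mul, map_mul,
      ← Algebra.smul_def]
  | mem F hF =>
    obtain ⟨a, rfl, rfl⟩ := hF
    have ha : a ≠ 0 := by rintro rfl; simp at hk
    obtain ⟨α, hα⟩ := Finsupp.ne_iff.mp ha
    by_cases hs : a = Finsupp.single α 1
    · have : hx.monomialBasis a = x α := by
        rw [← one_smul ℂ (hx.monomialBasis a), ← hx.equiv_monomial, hs, ← X, hx.equiv_X]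
      rw [this, hx.taylorHom_apply]
    -- A product of at least two basic invariants has total degree at most `dₙ`, so each factor has
    -- degree strictly below `dₙ` and vanishes at `q`; no constants need subtracting.
    · have hzero : ∀ β, a β ≠ 0 → evalAt q (x β : PolyAlg V) = 0 := by
        intro β hβ
        refine h.evalAt_eq_zero (hx.degree_pos β) (lt_of_lt_of_le ?_ hkN) (hx.homogeneous β)
        obtain ⟨a', rfl⟩ : ∃ a', a = a' + Finsupp.single β 1 :=
          ⟨a - Finsupp.single β 1, (tsub_add_cancel_of_le (Finsupp.single_le_iff.mpr
            (Nat.one_le_iff_ne_zero.mpr hβ))).symm⟩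
        have ha' : a' ≠ 0 := by
          rintro rfl
          rw [zero_add] at hs hα
          apply hs
          obtain rfl : β = α := by
            by_contra hne
            simp [Finsupp.single_eq_of_ne' hne] at hα
          rfl
        obtain ⟨m, hm⟩ := Finsupp.ne_iff.mp ha'
        have h1 := Finsupp.le_weight_of_ne_zero' d hm
        have h2 := hx.degree_pos m
        rw [map_add, Finsupp.weight_single, one_smul]
        omega
      rw [hx.monomialBasis_apply]
      have e1 : evalAt q ((∏ β, x β ^ a β : invariants G) : PolyAlg V) = 0 := by
        rw [← Subalgebra.coe_val, map_prod, map_prod]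
        refine Finset.prod_eq_zero (Finset.mem_univ α) ?_
        rw [map_pow, map_pow, Subalgebra.coe_val, hzero α hα, zero_pow hα]
      rw [e1, map_zero, sub_zero, ← Subalgebra.coe_val, map_prod, map_prod, map_prod]
      refine Finset.prod_congr rfl fun β _ => ?_
      by_cases hβ : a β = 0
      · simp [hβ]
      · rw [map_pow, map_pow, map_pow, hx.taylorHom_apply, hzero β hβ, map_zero, sub_zero,
          Subalgebra.coe_val]

theorem IsRegularEigenvector.taylorHom_eq (h : IsRegularEigenvector G d g ζ q)
    (hx : IsBasicInvariants G d x) {x' : Fin n → invariants G} (hx' : IsBasicInvariants G d x')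
    (z : Basis (Fin n) ℂ (Dual ℂ V)) : hx'.taylorHom q = hx.taylorHom q :=
  hx'.algHom_ext fun α => by
    rw [hx'.taylorHom_apply,
      h.taylorHom_of_mem hx z (hx.degree_pos α) (le_topDegree d α) (hx'.homogeneous α)]

/-! ### Adapted coordinates: weights in `φ`, and the isomorphism `ψ` -/

section Adapted

variable {z : Basis (Fin n) ℂ (Dual ℂ V)}

theorem IsRegularEigenvector.weightMod_generator (h : IsRegularEigenvector G d g ζ q)
    (hx : IsBasicInvariants G d x) (hz : IsAdapted d g ζ z) (α : Fin n) :
    WeightMod d (topDegree d) (d α) (coordEquiv z (hx.taylorHom q (x α))) := by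
  intro b hb
  rw [hx.taylorHom_apply, map_sub, AlgEquiv.commutes, algebraMap_eq, coeff_sub, coeff_C] at hb
  -- Subtracting `x^α(q)` removes the constant term. This matters when `d_α = dₙ`: weight `0` has
  -- the right residue but lies below `d_α`.
  have hb0 : b ≠ 0 := by
    rintro rfl
    simp [constantCoeff_translate] at hb
  rw [if_neg hb0.symm, sub_zero] at hb
  refine exists_add_mul_of_pow_eq h.primitive (le_topDegree d α) (hx.degree_pos α) ?_
    (pow_weight_eq_of_coeff_ne_zero h.ne_zero hz ?_ hb)
  · obtain ⟨m, hm⟩ := Finsupp.ne_iff.mp hb0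
    exact (hx.degree_pos m).trans_le (Finsupp.le_weight_of_ne_zero' d hm)
  · rw [twist_translate h.apply_eq, twist_invariant h.mem ζ (hx.homogeneous α), map_smul]

theorem IsBasicInvariants.coordEquiv_taylorHom_monomialBasis (hx : IsBasicInvariants G d x)
    (a : Fin n →₀ ℕ) :
    coordEquiv z (hx.taylorHom q (hx.monomialBasis a)) =
      ∏ α, coordEquiv z (hx.taylorHom q (x α)) ^ a α := by
  simp only [hx.monomialBasis_apply, map_prod, map_pow]

theorem IsRegularEigenvector.weightMod_monomialBasis (h : IsRegularEigenvector G d g ζ q)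
    (hx : IsBasicInvariants G d x) (hz : IsAdapted d g ζ z) (a : Fin n →₀ ℕ) :
    WeightMod d (topDegree d) (Finsupp.weight d a)
      (coordEquiv z (hx.taylorHom q (hx.monomialBasis a))) := by
  rw [hx.coordEquiv_taylorHom_monomialBasis, ← wdeg_eq_weight, wdeg]
  exact WeightMod.prod _ fun α => (h.weightMod_generator hx hz α).pow (a α)

theorem mem_iSup_weightedPart_of_weightMod {N k : ℕ} {F : PolyAlg V}
    (hF : WeightMod d N k (coordEquiv z F)) : F ∈ ⨆ j : ℕ, weightedPart d z (k + N * j) := by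
  rw [← (coordEquiv z).symm_apply_apply F, (coordEquiv z F).as_sum, map_sum]
  refine Submodule.sum_mem _ fun b hb => ?_
  obtain ⟨j, hj⟩ := hF b (MvPolynomial.mem_support_iff.mp hb)
  rw [coordEquiv_symm_monomial]
  exact Submodule.smul_mem _ _
    (Submodule.mem_iSup_of_mem j (hj ▸ zpowMonomial_mem_weightedPart z d b))

theorem IsRegularEigenvector.map_taylorMap_le (h : IsRegularEigenvector G d g ζ q)
    (hx : IsBasicInvariants G d x) (hz : IsAdapted d g ζ z) (k : ℕ) :
    (invariantPart G k).map (taylorMap hx z q) ≤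
      ⨆ j : ℕ, weightedPart d z (k + topDegree d * j) := by
  rw [hx.taylorMap_eq, hx.invariantPart_eq_span z, Submodule.map_span, Submodule.span_le]
  rintro _ ⟨_, ⟨a, rfl, rfl⟩, rfl⟩
  exact mem_iSup_weightedPart_of_weightMod (h.weightMod_monomialBasis hx hz a)

/-- The lowest component of the Taylor expansion of `x^α - x^α(q)` in adapted coordinates. -/
def IsBasicInvariants.leadingPart (hx : IsBasicInvariants G d x) (z : Basis (Fin n) ℂ (Dual ℂ V))
    (q : V) (α : Fin n) : MvPolynomial (Fin n) ℂ :=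
  weightedHomogeneousComponent d (d α) (coordEquiv z (hx.taylorHom q (x α)))

/-- The algebra homomorphism sending `x^α` to the lowest component of its Taylor expansion. -/
def IsBasicInvariants.truncatedTaylorHom (hx : IsBasicInvariants G d x)
    (z : Basis (Fin n) ℂ (Dual ℂ V)) (q : V) : invariants G →ₐ[ℂ] PolyAlg V :=
  ((coordEquiv z).symm.toAlgHom.comp (aeval (hx.leadingPart z q))).comp hx.equiv.symm.toAlgHom

theorem IsRegularEigenvector.truncatedTaylorMap_eq (h : IsRegularEigenvector G d g ζ q)
    (hx : IsBasicInvariants G d x) (hz : IsAdapted d g ζ z) :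
    truncatedTaylorMap hx z q = (hx.truncatedTaylorHom z q).toLinearMap := by
  refine hx.monomialBasis.ext fun a => ?_
  rw [hx.truncatedTaylorMap_monomialBasis, hx.coordEquiv_taylorHom_monomialBasis,
    ← wdeg_eq_weight, wdeg, WeightGE.component_prod _
      fun α => (h.weightMod_generator hx hz α).weightGE.pow (a α)]
  simp_rw [(h.weightMod_generator hx hz _).weightGE.component_pow]
  simp [IsBasicInvariants.truncatedTaylorHom, hx.monomialBasis_apply,
    IsBasicInvariants.leadingPart]

/-- Changing adapted bases mixes only coordinates with the same eigenvalue of `g`. The degrees lie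
in `[1, dₙ]`, where powers of `ζ` are distinct, so equal eigenvalues mean equal weights. -/
theorem IsRegularEigenvector.coordEquiv_adapted (h : IsRegularEigenvector G d g ζ q)
    (hx : IsBasicInvariants G d x) (hz : IsAdapted d g ζ z)
    {z' : Basis (Fin n) ℂ (Dual ℂ V)} (hz' : IsAdapted d g ζ z') (α : Fin n) :
    IsWeightedHomogeneous d (coordEquiv z (lin (z' α))) (d α) := by
  intro b hb
  have htw : twist g ζ (lin (z' α)) = ζ ^ d α • lin (z' α) := by
    rw [twist_lin, hz' α, smul_smul, ← zpow_one_add₀ h.ne_zero, add_sub_cancel, zpow_natCast]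
  have hpow := pow_weight_eq_of_coeff_ne_zero h.ne_zero hz htw hb
  obtain ⟨β, rfl⟩ : ∃ β, b = Finsupp.single β 1 := by
    rw [coordEquiv_lin, coeff_sum] at hb
    obtain ⟨β, -, hβ⟩ := Finset.exists_ne_zero_of_sum_ne_zero hb
    rw [coeff_C_mul, coeff_X] at hβ
    refine ⟨β, ?_⟩
    by_contra hne
    simp [Ne.symm hne] at hβ
  rw [Finsupp.weight_single, one_smul] at hpow ⊢
  exact eq_of_pow_eq h.primitive (le_topDegree d α) (hx.degree_pos α) (le_topDegree d β)
    (hx.degree_pos β) hpow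

theorem IsRegularEigenvector.component_change (h : IsRegularEigenvector G d g ζ q)
    (hx : IsBasicInvariants G d x) (hz : IsAdapted d g ζ z)
    {z' : Basis (Fin n) ℂ (Dual ℂ V)} (hz' : IsAdapted d g ζ z') (k : ℕ) (F : PolyAlg V) :
    (coordEquiv z').symm (weightedHomogeneousComponent d k (coordEquiv z' F)) =
      (coordEquiv z).symm (weightedHomogeneousComponent d k (coordEquiv z F)) := by
  have := weightedHomogeneousComponent_map (w := d) (w' := d)
    (h := (coordEquiv z).toAlgHom.comp (coordEquiv z').symm.toAlgHom)
    (fun α => by simpa using h.coordEquiv_adapted hx hz hz' α) k (coordEquiv z' F)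
  rw [AlgEquiv.eq_symm_apply]
  simpa using this.symm

theorem IsRegularEigenvector.truncatedTaylorMap_change (h : IsRegularEigenvector G d g ζ q)
    (hx : IsBasicInvariants G d x) (hz : IsAdapted d g ζ z) {x' : Fin n → invariants G}
    (hx' : IsBasicInvariants G d x') {z' : Basis (Fin n) ℂ (Dual ℂ V)}
    (hz' : IsAdapted d g ζ z') : truncatedTaylorMap hx' z' q = truncatedTaylorMap hx z q := by
  refine hx.monomialBasis.ext fun a => ?_
  have ha : hx.monomialBasis a ∈ invariantPart G (Finsupp.weight d a) := by
    rw [hx.invariantPart_eq_span z]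
    exact Submodule.subset_span ⟨a, rfl, rfl⟩
  rw [hx'.truncatedTaylorMap_of_mem z' q ha, hx.truncatedTaylorMap_of_mem z q ha,
    h.taylorHom_eq hx hx' z, h.component_change hx hz hz']

theorem IsBasicInvariants.isWeightedHomogeneous_leadingPart (hx : IsBasicInvariants G d x)
    (α : Fin n) : IsWeightedHomogeneous d (hx.leadingPart z q α) (d α) :=
  weightedHomogeneousComponent_isWeightedHomogeneous ..

/-- Truncation loses no linear term: a `z^β` occurring in the expansion of `x^α` has weight `d_β =
d_α + dₙ j`, and `d_β ≤ dₙ` forces `j = 0`. -/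
theorem IsRegularEigenvector.coeff_single_leadingPart (h : IsRegularEigenvector G d g ζ q)
    (hx : IsBasicInvariants G d x) (hz : IsAdapted d g ζ z) (α β : Fin n) :
    coeff (Finsupp.single β 1) (hx.leadingPart z q α) = jacobianAt x z q α β := by
  classical
  have hJ : jacobianAt x z q α β =
      coeff (Finsupp.single β 1) (coordEquiv z (hx.taylorHom q (x α))) := by
    rw [jacobianAt_apply, hx.taylorHom_apply, map_sub, AlgEquiv.commutes, algebraMap_eq,
      coeff_sub, coeff_C, if_neg (Finsupp.single_ne_zero.mpr one_ne_zero).symm, sub_zero]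
  rw [IsBasicInvariants.leadingPart, coeff_weightedHomogeneousComponent, hJ, Finsupp.weight_single,
    one_smul]
  split_ifs with hd
  · rfl
  · by_contra hne
    obtain ⟨j, hj⟩ := h.weightMod_generator hx hz α _ (Ne.symm hne)
    rw [Finsupp.weight_single, one_smul] at hj
    have h1 := le_topDegree d β
    have h2 := hx.degree_pos α
    rcases Nat.eq_zero_or_pos j with rfl | hj0
    · omega
    · have := Nat.le_mul_of_pos_right (topDegree d) hj0
      omega

theorem IsRegularEigenvector.bijective_aeval_leadingPart (h : IsRegularEigenvector G d g ζ q)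
    (hx : IsBasicInvariants G d x) (hz : IsAdapted d g ζ z)
    (hJ : IsUnit (jacobianAt x z q).det) :
    Function.Bijective (aeval (R := ℂ) (hx.leadingPart z q)) := by
  refine bijective_aeval_of_adjoin_eq_top (adjoin_eq_top_of_isUnit_linearPart (w := d)
    hx.degree_pos (fun α => hx.isWeightedHomogeneous_leadingPart α) ?_)
  have hL : (Matrix.of fun α β => coeff (Finsupp.single β 1) (hx.leadingPart z q α)) =
      jacobianAt x z q :=
    Matrix.ext fun α β => h.coeff_single_leadingPart hx hz α β
  rw [hL]
  exact hJ

theorem IsRegularEigenvector.bijective_truncatedTaylorHom (h : IsRegularEigenvector G d g ζ q)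
    (hx : IsBasicInvariants G d x) (hz : IsAdapted d g ζ z)
    (hJ : IsUnit (jacobianAt x z q).det) :
    Function.Bijective (hx.truncatedTaylorHom z q) :=
  (coordEquiv z).symm.bijective.comp
    ((h.bijective_aeval_leadingPart hx hz hJ).comp hx.equiv.symm.bijective)

theorem IsRegularEigenvector.map_truncatedTaylorHom (h : IsRegularEigenvector G d g ζ q)
    (hx : IsBasicInvariants G d x) (hz : IsAdapted d g ζ z)
    (hJ : IsUnit (jacobianAt x z q).det) (j : ℕ) :
    (invariantPart G j).map (hx.truncatedTaylorHom z q).toLinearMap = weightedPart d z j := by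
  have hbij := h.bijective_truncatedTaylorHom hx hz hJ
  have key : ∀ F : invariants G,
      F ∈ invariantPart G j ↔ hx.truncatedTaylorHom z q F ∈ weightedPart d z j := by
    intro F
    rw [mem_weightedPart_iff, hx.mem_invariantPart_iff z,
      ← isWeightedHomogeneous_map_iff (h := aeval (hx.leadingPart z q)) (w' := d)
        (fun α => by rw [aeval_X]; exact hx.isWeightedHomogeneous_leadingPart α)
        (h.bijective_aeval_leadingPart hx hz hJ).1]
    simp [IsBasicInvariants.truncatedTaylorHom]
  ext F
  obtain ⟨F', rfl⟩ := hbij.2 F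
  rw [← key, Submodule.mem_map]
  refine ⟨?_, fun hF => ⟨F', hF, rfl⟩⟩
  rintro ⟨F'', hF'', he⟩
  exact hbij.1 he ▸ hF''

end Adapted

theorem IsAdmissible.isRegularEigenvector [FiniteDimensional ℂ V] (hn : finrank ℂ V = n)
    (hx : IsBasicInvariants G d x) (h : IsAdmissible G d x g ζ q) :
    IsRegularEigenvector G d g ζ q where
  mem := h.mem
  apply_eq := h.eigenvector.apply_eq_smul
  primitive := h.primitive
  topDegree_pos := by
    -- For `n = 0` the supremum defining `topDegree` would be `0`; the nonzero vector `q` excludes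
    -- this.
    have : Nontrivial V := ⟨⟨q, 0, h.eigenvector.2⟩⟩
    have hn0 : 0 < n := hn ▸ finrank_pos
    exact (hx.degree_pos ⟨0, hn0⟩).trans_le (le_topDegree d _)

end ReflectionInvariants

end

theorem proposition3p2 {V : Type*} [AddCommGroup V] [Module ℂ V] [FiniteDimensional ℂ V]
    {n : ℕ} (hn : Module.finrank ℂ V = n)
    (G : Subgroup (V ≃ₗ[ℂ] V)) (hG : IsFiniteReflectionGroup G)
    (d : Fin n → ℕ) (x : Fin n → invariants G) (hx : IsBasicInvariants G d x)
    (g : V ≃ₗ[ℂ] V) (ζ : ℂ) (q : V) (hadm : IsAdmissible G d x g ζ q)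
    (z : Module.Basis (Fin n) ℂ (Module.Dual ℂ V)) (hz : IsAdapted d g ζ z) :
    -- (i) `φ` does not depend on the basic invariants and the coordinates, and is a homomorphism
    ((∀ (d' : Fin n → ℕ) (x' : Fin n → invariants G) (hx' : IsBasicInvariants G d' x')
        (z' : Module.Basis (Fin n) ℂ (Module.Dual ℂ V)),
        taylorMap hx' z' q = taylorMap hx z q) ∧
      ∃ Φ : invariants G →ₐ[ℂ] PolyAlg V, Φ.toLinearMap = taylorMap hx z q) ∧
    -- (ii) `φ (S(k))` lies in the sum of the pieces of degree `k + dₙ j`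
    (∀ k : ℕ, (invariantPart G k).map (taylorMap hx z q) ≤
      ⨆ j : ℕ, weightedPart d z (k + topDegree d * j)) ∧
    -- (iii) `ψ` does not depend on the basic invariants and the (adapted) coordinates, and is a
    -- homomorphism
    ((∀ (d' : Fin n → ℕ) (x' : Fin n → invariants G) (hx' : IsBasicInvariants G d' x')
        (z' : Module.Basis (Fin n) ℂ (Module.Dual ℂ V)), IsAdapted d' g ζ z' →
        truncatedTaylorMap hx' z' q = truncatedTaylorMap hx z q) ∧
      ∃ Ψ : invariants G →ₐ[ℂ] PolyAlg V, Ψ.toLinearMap = truncatedTaylorMap hx z q) ∧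
    -- (iv) the `S(j)` and the `V(g, ζ, q)(j)` are algebra gradings, and `ψ` is an isomorphism of
    -- graded algebras between them
    (Nonempty (GradedAlgebra (invariantPart G)) ∧ Nonempty (GradedAlgebra (weightedPart d z)) ∧
      ∃ Ψ : invariants G ≃ₐ[ℂ] PolyAlg V, Ψ.toLinearMap = truncatedTaylorMap hx z q ∧
        ∀ j : ℕ, (invariantPart G j).map (truncatedTaylorMap hx z q) = weightedPart d z j) := by
  have h := hadm.isRegularEigenvector hn hx
  obtain ⟨z₀, hz₀⟩ := hadm.jacobian
  have hJ := isUnit_det_jacobianAt hz₀ z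
  have hψ := h.truncatedTaylorMap_eq hx hz
  refine ⟨⟨fun d' x' hx' z' => ?_, hx.taylorHom q, (hx.taylorMap_eq z q).symm⟩,
    h.map_taylorMap_le hx hz, ⟨fun d' x' hx' z' hz' => ?_, hx.truncatedTaylorHom z q, hψ.symm⟩,
    gradedAlgebra_map_weightedHomogeneousSubmodule d hx.equiv _ (hx.invariantPart_eq_map z),
    gradedAlgebra_map_weightedHomogeneousSubmodule d (SymmetricAlgebra.equivMvPolynomial z).symm _
      (weightedPart_eq_map z d),
    AlgEquiv.ofBijective _ (h.bijective_truncatedTaylorHom hx hz hJ), hψ.symm,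
    fun j => hψ ▸ h.map_truncatedTaylorHom hx hz hJ j⟩
  -- The degrees must be identified first: the comparison of `φ` uses that each `x' α` has degree in
  -- `[1, dₙ]`.
  · obtain rfl := hx.degree_eq hx' z
    rw [hx'.taylorMap_eq, hx.taylorMap_eq, h.taylorHom_eq hx hx' z]
  · obtain rfl := hx.degree_eq hx' z
    exact h.truncatedTaylorMap_change hx hz hx' hz'
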